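/- **Theorem (generalized Assmus–Mattson theorem).** Let $q$ be a prime power and let $\mathcal C\subseteq \mathrm{GF}(q)^\nu$ be a linear code of length $\nu$ and minimum weight $d$, i.e. $d$ is the least Hamming weight of a nonzero codeword; let $\mathcal C^{\perp}$ be its dual code with respect to the standard bilinear form $\sum_i x_iy_i$, with minimum weight $d^{\perp}$. Let $\mathcal P$ be the set of the $\nu$ coordinate positions. For a linear code $\mathcal D\subseteq\mathrm{GF}(q)^\nu$ and $0\le k\le\nu$ let $\mathcal B_k(\mathcal D)$ be the multiset of the supports of the codewords of weight $k$ in $\mathcal D$, with all multiplicities divided by $q-1$. (For $k\ge 1$ this division is exact; for $k=0$ the multiplicity $1/(q-1)$ of the empty block is rounded down, which does not affect the design property below.) For $1\le t\le\nu$, the pair $(\mathcal P,\mathcal B)$, with $\mathcal B$ a finite multiset of $k$-subsets of $\mathcal P$ (possibly empty, $0\le k\le\nu$), is a $t$-design if there is an integer $\lambda\ge 0$ such that every $t$-subset of $\mathcal P$ is contained in exactly $\lambda$ members of $\mathcal B$, counted with multiplicity; it is simple if $\mathcal B$ has no repeated members. Let $s$ and $t$ be positive integers with $t<\min\{d,d^{\perp}\}$,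 and let $S$ be an $s$-element subset of $\{d,d+1,\dots,\nu-t\}$. Suppose that $(\mathcal P,\mathcal B_{\ell}(\mathcal C))$ is a $t$-design for every $\ell\in\{d,d+1,\dots,\nu-t\}\setminus S$, and that $(\mathcal P,\mathcal B_{\ell}(\mathcal C^{\perp}))$ is a $t$-design for every $0\le \ell\le s+t-1$. Then $(\mathcal P,\mathcal B_k(\mathcal C))$ and $(\mathcal P,\mathcal B_k(\mathcal C^{\perp}))$ are $t$-designs for every $k$ with $t\le k\le\nu$. Moreover: - $(\mathcal P,\mathcal B_k(\mathcal C))$ is a simple $t$-design for every $k$ with $d\le k\le w$, where $w$ is the largest integer with $w\le\nu$ and $$w-\left\lfloor\frac{w+q-2}{q-1}\right\rfloor<d;$$ - $(\mathcal P,\mathcal B_k(\mathcal C^{\perp}))$ is a simple $t$-design for every $k$ with $\min\{d,d^{\perp}\}\le k\le w^{\perp}$, where $w^{\perp}$ is the largest integer with $w^{\perp}\le\nu$ and $$w^{\perp}-\left\lfloor\frac{w^{\perp}+q-2}{q-1}\right\rfloor<d^{\perp}.$$ -/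

import Mathlib

namespace DesignCode

/-- `(P, B)` is a `t`-`(ν, k, lam)` design, where `ν` is the number of points: `B` is a finite
multiset of `k`-subsets of `P` and every `t`-subset of `P` is contained in exactly `lam` members
of `B`, counted with multiplicity. -/
structure IsDesign {P : Type*} [Fintype P] [DecidableEq P]
    (B : Multiset (Finset P)) (t k lam : ℕ) : Prop where
  one_le_t : 1 ≤ t
  t_le_card : t ≤ Fintype.card P
  k_le_card : k ≤ Fintype.card P
  card_block : ∀ b ∈ B, b.card = k
  card_containing : ∀ T : Finset P, T.card = t → (B.filter fun b => T ⊆ b).card = lam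

/-- `(P, B)` is a `t`-design with block size `k` (for some `lam`). -/
def IsTDesign {P : Type*} [Fintype P] [DecidableEq P]
    (B : Multiset (Finset P)) (t k : ℕ) : Prop :=
  ∃ lam : ℕ, IsDesign B t k lam

/-- A `t`-design with block size `k` and without repeated blocks. -/
def IsSimpleTDesign {P : Type*} [Fintype P] [DecidableEq P]
    (B : Multiset (Finset P)) (t k : ℕ) : Prop :=
  IsTDesign B t k ∧ B.Nodup

/-- The multiset `(1/n) M`: all multiplicities of `M` are divided by `n`. -/
def divMult {α : Type*} [DecidableEq α] (n : ℕ) (M : Multiset α) : Multiset α :=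
  ∑ a ∈ M.toFinset, Multiset.replicate (M.count a / n) a

theorem count_divMult {α : Type*} [DecidableEq α] (n : ℕ) (M : Multiset α) (a : α) :
    (divMult n M).count a = M.count a / n := by
  unfold divMult
  rw [Multiset.count_sum']
  simp only [Multiset.count_replicate]
  rw [Finset.sum_ite_eq']
  split_ifs with h
  · rfl
  · rw [Multiset.mem_toFinset] at h
    simp [Multiset.count_eq_zero_of_notMem h]

/-- The support of a word. -/
def supp {F : Type*} [Field F] [DecidableEq F] {ν : ℕ} (c : Fin ν → F) : Finset (Fin ν) :=
  Finset.univ.filter fun i => c i ≠ 0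

/-- The dual of a linear code with respect to the standard bilinear form. -/
def dualCode {F : Type*} [Field F] {ν : ℕ} (C : Submodule F (Fin ν → F)) :
    Submodule F (Fin ν → F) where
  carrier := {x | ∀ c ∈ C, ∑ i, x i * c i = 0}
  zero_mem' := by
    intro c _
    simp
  add_mem' := by
    intro x y hx hy c hc
    simp only [Pi.add_apply, add_mul, Finset.sum_add_distrib]
    rw [hx c hc, hy c hc, add_zero]
  smul_mem' := by
    intro a x hx c hc
    simp only [Pi.smul_apply, smul_eq_mul, mul_assoc]
    rw [← Finset.mul_sum, hx c hc, mul_zero]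

/-- The minimum weight of a code: the least Hamming weight of a nonzero codeword
(with value `0` for the zero code, which has no nonzero codeword). -/
noncomputable def minWeight {F : Type*} [Field F] [DecidableEq F] {ν : ℕ}
    (C : Submodule F (Fin ν → F)) : ℕ :=
  sInf {w | ∃ c ∈ C, c ≠ 0 ∧ hammingNorm c = w}

open Classical in
/-- The multiset of the supports of all codewords of weight `k`. -/
noncomputable def supports {F : Type*} [Field F] [Fintype F] [DecidableEq F] {ν : ℕ}
    (C : Submodule F (Fin ν → F)) (k : ℕ) : Multiset (Finset (Fin ν)) :=
  (Finset.univ.filter fun c : Fin ν → F => c ∈ C ∧ hammingNorm c = k).val.map supp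

/-- The block multiset `B_k(C)`: the supports of the codewords of weight `k`, with multiplicities
divided by `q - 1`. For `k ≥ 1` the division is exact, because the nonzero scalar multiples of a
codeword have the same support. -/
noncomputable def blocks {F : Type*} [Field F] [Fintype F] [DecidableEq F] {ν : ℕ}
    (C : Submodule F (Fin ν → F)) (k : ℕ) : Multiset (Finset (Fin ν)) :=
  divMult (Fintype.card F - 1) (supports C k)

/-- `w` is the largest integer with `w ≤ ν` and `w - ⌊(w + q - 2) / (q - 1)⌋ < d`
(integer division by the positive number `q - 1` rounds down). -/
def IsSimpleBound (q ν d : ℕ) (w : ℤ) : Prop :=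
  IsGreatest {w : ℤ | w ≤ (ν : ℤ) ∧ w - (w + (q : ℤ) - 2) / ((q : ℤ) - 1) < (d : ℤ)} w

end DesignCode

/-! The design property is treated as a regularity statement: for |T| ≤ t, the number of words of
weight k whose support contains T depends only on |T| (`CoverRegular`). By inclusion–exclusion, this
is equivalent to the same statement for supports disjoint from T, that is, for the weight
distribution of the subcode of C vanishing on T.

That distribution is controlled by the dual code. For each coordinate set V, q^|V| times the number
of words of C vanishing on V equals |C| times the number of dual words supported in V
(`card_pow_mul_card_disjoint`). Summing over V ⊇ T with |V| = |T| + m gives on the C side the m-th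
binomial moment of the distribution. On the dual side it gives a sum over dual words y that depends
only on |T ∪ supp y| and involves only weights at most |T| + m. Regularity of the dual in weights
below n + |T| therefore fixes the first n moments, and by a Vandermonde argument n moments determine
n unknown entries (`card_disjoint_eq_of_dual`).

For |T| = i the unknown weights of C are those in S and those in (ν - t, ν - i], at most s + t - i
in number, so dual weights below s + t suffice. Once C is regular in every weight, the same transfer
with the roles exchanged gives its dual (`coverRegular_words_of_dual`).

Simplicity is a pigeonhole argument: two words with the same support of size k agree, up to a common
scalar, in at least ⌈k/(q-1)⌉ positions of it. Below the bound, the difference is then lighter than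
the minimum weight, hence zero (`exists_smul_eq_of_supp_eq`). -/

namespace DesignCode

open Finset

/-! ### Binomial moments -/

/-- A function on a finite set of natural numbers (indexed injectively by `n`) is determined by as
many binomial moments as the set has elements. -/
theorem eq_zero_of_sum_mul_choose_eq_zero {κ : Type*} [DecidableEq κ] (S : Finset κ) (n : κ → ℕ)
    (hn : Set.InjOn n S) (x : κ → ℚ)
    (h : ∀ m < S.card, ∑ k ∈ S, x k * ((n k).choose m : ℚ) = 0) :
    ∀ k ∈ S, x k = 0 := by
  let e : Fin S.card ≃ S := S.equivFin.symm
  let v : Fin S.card → ℚ := fun i => (n (e i) : ℚ)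
  have hv : Function.Injective v := by
    intro i j hij
    have h1 : n (e i) = n (e j) := Nat.cast_injective (R := ℚ) hij
    exact e.injective (Subtype.ext (hn (e i).2 (e j).2 h1))
  -- Falling factorials are monic of degree i, so their evaluation matrix has the Vandermonde
  -- determinant; they equal m! times the binomial coefficients.
  have hdet := Matrix.det_eval_matrixOfPolynomials_eq_det_vandermonde v
    (fun i => descPochhammer ℚ i) (fun i => descPochhammer_natDegree ℚ i)
    (fun i => monic_descPochhammer ℚ i)
  have hne := Matrix.det_vandermonde_ne_zero_iff.mpr hv
  rw [hdet] at hne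
  have hzero : (fun i => x (e i)) = 0 := by
    apply Matrix.eq_zero_of_vecMul_eq_zero hne
    funext j
    have hj := h j j.2
    rw [← Finset.sum_coe_sort, ← Equiv.sum_comp e] at hj
    simp only [Matrix.vecMul, dotProduct, Matrix.of_apply, v, descPochhammer_eval_eq_descFactorial,
      Nat.descFactorial_eq_factorial_mul_choose, Nat.cast_mul, Pi.zero_apply]
    rw [← mul_zero ((Nat.factorial j : ℕ) : ℚ), ← hj, Finset.mul_sum]
    exact Finset.sum_congr rfl fun i _ => by ring
  intro k hk
  have := congrFun hzero (e.symm ⟨k, hk⟩)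
  simpa using this

theorem eq_of_sum_mul_choose_eq {κ : Type*} [DecidableEq κ] (S : Finset κ) (n : κ → ℕ)
    (hn : Set.InjOn n S) (x y : κ → ℕ)
    (h : ∀ m < S.card, ∑ k ∈ S, x k * (n k).choose m = ∑ k ∈ S, y k * (n k).choose m) :
    ∀ k ∈ S, x k = y k := by
  intro k hk
  have := eq_zero_of_sum_mul_choose_eq_zero S n hn (fun k => (x k : ℚ) - y k) (by
    intro m hm
    have h1 : (∑ k ∈ S, (x k : ℚ) * (n k).choose m) = ∑ k ∈ S, (y k : ℚ) * (n k).choose m := by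
      exact_mod_cast h m hm
    simp only [sub_mul, Finset.sum_sub_distrib, h1, sub_self]) k hk
  exact_mod_cast sub_eq_zero.mp this

/-! ### Regular families of sets -/

variable {P : Type*} [DecidableEq P]

/-- The number of `(|X| + m)`-sets between `X` and `Z`. -/
theorem card_filter_between [Fintype P] (X Z : Finset P) (h : X ⊆ Z) (m : ℕ) :
    (univ.filter fun V : Finset P => X ⊆ V ∧ V ⊆ Z ∧ V.card = X.card + m).card =
      (Z.card - X.card).choose m := by
  rw [← card_sdiff_of_subset h, ← card_powersetCard]
  refine card_bij' (fun V _ => V \ X) (fun U _ => X ∪ U) ?_ ?_ ?_ ?_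
  · intro V hV
    simp only [mem_filter, mem_univ, true_and] at hV
    rw [mem_powersetCard]
    refine ⟨sdiff_subset_sdiff hV.2.1 subset_rfl, ?_⟩
    rw [card_sdiff_of_subset hV.1, hV.2.2, Nat.add_sub_cancel_left]
  · intro U hU
    rw [mem_powersetCard] at hU
    have hd : Disjoint X U := disjoint_of_subset_right hU.1 disjoint_sdiff
    simp only [mem_filter, mem_univ, true_and]
    exact ⟨subset_union_left, union_subset h (hU.1.trans sdiff_subset),
      by rw [card_union_of_disjoint hd, hU.2]⟩
  · intro V hV
    simp only [mem_filter, mem_univ, true_and] at hV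
    exact union_sdiff_of_subset hV.1
  · intro U hU
    rw [mem_powersetCard] at hU
    have hd : Disjoint X U := disjoint_of_subset_right hU.1 disjoint_sdiff
    exact union_sdiff_cancel_left hd

theorem card_filter_supersets_card_eq [Fintype P] (X X' : Finset P) (h : X.card = X'.card)
    (r : ℕ) :
    (univ.filter fun V : Finset P => X ⊆ V ∧ V.card = r).card =
      (univ.filter fun V : Finset P => X' ⊆ V ∧ V.card = r).card := by
  by_cases hr : X.card ≤ r
  · obtain ⟨m, rfl⟩ := Nat.exists_eq_add_of_le hr
    have h1 := card_filter_between X univ (subset_univ _) m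
    have h2 := card_filter_between X' univ (subset_univ _) m
    simp only [subset_univ, true_and] at h1 h2
    rw [h1, h, h2]
  · rw [filter_false_of_mem, filter_false_of_mem]
    · rintro V - ⟨h1, h2⟩
      have := card_le_card h1
      omega
    · rintro V - ⟨h1, h2⟩
      have := card_le_card h1
      omega

variable {ι : Type*}

/-- The number of members of the family `a` (indexed by `A`) containing `T` depends only on the
size of `T`, for sets `T` with at most `t` elements. -/
def CoverRegular (A : Finset ι) (a : ι → Finset P) (t : ℕ) : Prop :=
  ∀ T T' : Finset P, T.card = T'.card → T.card ≤ t →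
    (A.filter fun x => T ⊆ a x).card = (A.filter fun x => T' ⊆ a x).card

/-- Both sides count pairs of a member x and an m-subset I of a x ∩ T. Covering numbers are thus the
binomial moments of the intersection sizes. -/
theorem sum_card_inter_choose (A : Finset ι) (a : ι → Finset P) (T : Finset P) (m : ℕ) :
    ∑ j ∈ range (T.card + 1), (A.filter fun x => (a x ∩ T).card = j).card * j.choose m =
      ∑ I ∈ T.powersetCard m, (A.filter fun x => I ⊆ a x).card := by
  have hmaps : ∀ x ∈ A, (a x ∩ T).card ∈ range (T.card + 1) := fun x _ =>
    mem_range.mpr (Nat.lt_succ_of_le (card_le_card inter_subset_right))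
  have h1 : ∑ j ∈ range (T.card + 1), (A.filter fun x => (a x ∩ T).card = j).card * j.choose m =
      ∑ x ∈ A, (a x ∩ T).card.choose m := by
    rw [← sum_fiberwise_of_maps_to hmaps]
    refine sum_congr rfl fun j _ => ?_
    rw [← smul_eq_mul, ← sum_const]
    exact sum_congr rfl fun x hx => by rw [(mem_filter.mp hx).2]
  rw [h1]
  simp only [card_filter]
  rw [sum_comm]
  refine sum_congr rfl fun x _ => ?_
  rw [← card_filter, ← card_powersetCard]
  congr 1
  ext I
  simp only [mem_powersetCard, mem_filter, subset_inter_iff]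
  tauto

theorem CoverRegular.card_inter {A : Finset ι} {a : ι → Finset P} {t : ℕ}
    (h : CoverRegular A a t) (T T' : Finset P) (hT : T.card = T'.card) (ht : T.card ≤ t) (j : ℕ) :
    (A.filter fun x => (a x ∩ T).card = j).card =
      (A.filter fun x => (a x ∩ T').card = j).card := by
  by_cases hj : j ∈ range (T.card + 1)
  · refine eq_of_sum_mul_choose_eq (range (T.card + 1)) id (Set.injOn_id _)
      (fun j => (A.filter fun x => (a x ∩ T).card = j).card)
      (fun j => (A.filter fun x => (a x ∩ T').card = j).card) ?_ j hj
    intro m hm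
    rw [card_range] at hm
    simp only [id]
    rw [sum_card_inter_choose, hT, sum_card_inter_choose]
    -- Since m ≤ |T| ≤ t, all m-sets have the same covering number; `I₀` supplies it.
    obtain ⟨I₀, hI₀, hI₀c⟩ := exists_subset_card_eq (show m ≤ T.card by omega)
    have key : ∀ I : Finset P, I.card = m →
        (A.filter fun x => I ⊆ a x).card = (A.filter fun x => I₀ ⊆ a x).card :=
      fun I hI => h _ _ (by omega) (by omega)
    rw [sum_congr rfl fun I hI => key I (mem_powersetCard.mp hI).2,
      sum_congr (s₁ := T'.powersetCard m) rfl fun I hI => key I (mem_powersetCard.mp hI).2,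
      sum_const, sum_const, card_powersetCard, card_powersetCard, hT]
  · rw [mem_range] at hj
    rw [filter_false_of_mem, filter_false_of_mem]
    · intro x _ hx
      have := card_le_card (inter_subset_right : a x ∩ T' ⊆ T')
      omega
    · intro x _ hx
      have := card_le_card (inter_subset_right : a x ∩ T ⊆ T)
      omega

theorem CoverRegular.card_disjoint {A : Finset ι} {a : ι → Finset P} {t : ℕ}
    (h : CoverRegular A a t) (T T' : Finset P) (hT : T.card = T'.card) (ht : T.card ≤ t) :
    (A.filter fun x => Disjoint (a x) T).card = (A.filter fun x => Disjoint (a x) T').card := by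
  simpa only [card_eq_zero, ← disjoint_iff_inter_eq_empty] using h.card_inter T T' hT ht 0

/-- Being disjoint from T means that the complement covers T, so this is
`CoverRegular.card_disjoint` for the complementary family. -/
theorem coverRegular_of_card_disjoint [Fintype P] {A : Finset ι} {a : ι → Finset P} {t : ℕ}
    (h : ∀ T T' : Finset P, T.card = T'.card → T.card ≤ t →
      (A.filter fun x => Disjoint (a x) T).card = (A.filter fun x => Disjoint (a x) T').card) :
    CoverRegular A a t := by
  have h1 : CoverRegular A (fun x => (a x)ᶜ) t := by
    intro T T' hT ht
    simpa only [subset_compl_iff_disjoint_left] using h T T' hT ht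
  intro T T' hT ht
  simpa only [disjoint_compl_left_iff] using h1.card_disjoint T T' hT ht

theorem coverRegular_of_empty {A : Finset ι} {a : ι → Finset P} (t : ℕ)
    (h : ∀ x ∈ A, a x = ∅) : CoverRegular A a t := by
  intro T T' hT _
  congr 1
  refine filter_congr fun x hx => ?_
  rw [h x hx, subset_empty, subset_empty, ← card_eq_zero, ← card_eq_zero, hT]

/-- In a family of `k`-sets with `t ≤ k`, regularity for `t`-sets implies regularity for all
smaller sets. -/
theorem coverRegular_of_card_eq [Fintype P] {A : Finset ι} {a : ι → Finset P} {t k : ℕ}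
    (hk : ∀ x ∈ A, (a x).card = k) (htk : t ≤ k)
    (h : ∀ T T' : Finset P, T.card = t → T'.card = t →
      (A.filter fun x => T ⊆ a x).card = (A.filter fun x => T' ⊆ a x).card) :
    CoverRegular A a t := by
  -- Double count of pairs (x, V) with T ⊆ V ⊆ a x and |V| = t. The factor on the right is nonzero
  -- because t ≤ k.
  have count : ∀ T : Finset P, T.card ≤ t →
      ∑ V ∈ univ.filter (fun V : Finset P => T ⊆ V ∧ V.card = t),
        (A.filter fun x => V ⊆ a x).card =
      (A.filter fun x => T ⊆ a x).card * (k - T.card).choose (t - T.card) := by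
    intro T hT
    simp only [card_filter _ A]
    rw [sum_comm, sum_mul]
    refine sum_congr rfl fun x hx => ?_
    rw [← card_filter, filter_filter]
    split_ifs with hTx
    · rw [one_mul, ← hk x hx, ← card_filter_between T (a x) hTx (t - T.card)]
      congr 1
      refine filter_congr fun V _ => ?_
      rw [Nat.add_sub_cancel' hT]
      tauto
    · rw [zero_mul, card_eq_zero, filter_false_of_mem]
      rintro V - ⟨⟨h1, -⟩, h2⟩
      exact hTx (h1.trans h2)
  intro T T' hT ht
  have h1 := count T ht
  have h2 := count T' (hT ▸ ht)
  have hpos : 0 < (k - T.card).choose (t - T.card) := Nat.choose_pos (by omega)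
  have hsum : ∑ V ∈ univ.filter (fun V : Finset P => T ⊆ V ∧ V.card = t),
        (A.filter fun x => V ⊆ a x).card =
      ∑ V ∈ univ.filter (fun V : Finset P => T' ⊆ V ∧ V.card = t),
        (A.filter fun x => V ⊆ a x).card := by
    -- If t exceeds the number of points, both sums are empty.
    by_cases hex : ∃ V₀ : Finset P, V₀.card = t
    · obtain ⟨V₀, hV₀⟩ := hex
      rw [sum_congr rfl fun V hV => h V V₀ (mem_filter.mp hV).2.2 hV₀,
        sum_congr (s₁ := univ.filter fun V : Finset P => T' ⊆ V ∧ V.card = t) rfl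
          fun V hV => h V V₀ (mem_filter.mp hV).2.2 hV₀,
        sum_const, sum_const, card_filter_supersets_card_eq T T' hT]
    · rw [filter_false_of_mem, filter_false_of_mem]
      · exact fun V _ hV => hex ⟨V, hV.2⟩
      · exact fun V _ hV => hex ⟨V, hV.2⟩
  rw [h1, h2, ← hT] at hsum
  exact Nat.eq_of_mul_eq_mul_right hpos hsum

/-! ### Moment identities and transfer from a dual family -/

variable {κ : Type*}

/-- The dual side of the MacWilliams-type identities. -/
theorem sum_supersets_card_eq [Fintype P] (B : Finset κ) (b : κ → Finset P) (T T' : Finset P)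
    (hT : T.card = T'.card) (r : ℕ)
    (h : ∀ w j : ℕ, w ≤ r →
      (B.filter fun y => (b y).card = w ∧ (b y ∩ T).card = j).card =
        (B.filter fun y => (b y).card = w ∧ (b y ∩ T').card = j).card) :
    ∑ V ∈ univ.filter (fun V : Finset P => T ⊆ V ∧ V.card = r), (B.filter fun y => b y ⊆ V).card =
      ∑ V ∈ univ.filter (fun V : Finset P => T' ⊆ V ∧ V.card = r),
        (B.filter fun y => b y ⊆ V).card := by
  have swap : ∀ T : Finset P,
      ∑ V ∈ univ.filter (fun V : Finset P => T ⊆ V ∧ V.card = r),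
        (B.filter fun y => b y ⊆ V).card =
      ∑ y ∈ B, (univ.filter fun V : Finset P => T ∪ b y ⊆ V ∧ V.card = r).card := by
    intro T
    simp only [card_filter _ B]
    rw [sum_comm]
    refine sum_congr rfl fun y _ => ?_
    rw [← card_filter, filter_filter]
    congr 1
    refine filter_congr fun V _ => ?_
    rw [union_subset_iff]
    tauto
  -- the number of `r`-sets containing a given `u`-set, as a function of `u`
  let g : ℕ → ℕ := fun u => if h : ∃ X : Finset P, X.card = u then
    (univ.filter fun V : Finset P => h.choose ⊆ V ∧ V.card = r).card else 0
  have hg : ∀ X : Finset P,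
      (univ.filter fun V : Finset P => X ⊆ V ∧ V.card = r).card = g X.card := by
    intro X
    have hX : ∃ Y : Finset P, Y.card = X.card := ⟨X, rfl⟩
    simp only [g, dif_pos hX]
    exact card_filter_supersets_card_eq _ _ hX.choose_spec.symm r
  -- This truncation is why only members of size at most r have to be known.
  have hg0 : ∀ X : Finset P, r < X.card → g X.card = 0 := by
    intro X hX
    rw [← hg, card_eq_zero, filter_false_of_mem]
    rintro V - ⟨h1, h2⟩
    have := card_le_card h1
    omega
  have split : ∀ T : Finset P, ∑ y ∈ B, g (T ∪ b y).card =
      ∑ p ∈ range (r + 1) ×ˢ range (T.card + 1),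
        (B.filter fun y => (b y).card = p.1 ∧ (b y ∩ T).card = p.2).card *
          g (T.card + p.1 - p.2) := by
    intro T
    have h0 : ∑ y ∈ B, g (T ∪ b y).card =
        ∑ y ∈ B.filter (fun y => (b y).card ≤ r), g (T ∪ b y).card := by
      rw [sum_filter]
      refine sum_congr rfl fun y _ => ?_
      split_ifs with hy
      · rfl
      · exact hg0 _ (lt_of_lt_of_le (not_le.mp hy) (card_le_card subset_union_right))
    have hmaps : ∀ y ∈ B.filter (fun y => (b y).card ≤ r),
        ((b y).card, (b y ∩ T).card) ∈ range (r + 1) ×ˢ range (T.card + 1) := by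
      intro y hy
      rw [mem_product, mem_range, mem_range]
      exact ⟨Nat.lt_succ_of_le (mem_filter.mp hy).2,
        Nat.lt_succ_of_le (card_le_card inter_subset_right)⟩
    rw [h0, ← sum_fiberwise_of_maps_to hmaps]
    refine sum_congr rfl fun p hp => ?_
    rw [mem_product, mem_range, mem_range] at hp
    rw [filter_filter, ← smul_eq_mul, ← sum_const]
    have hset : (B.filter fun y => (b y).card ≤ r ∧ ((b y).card, (b y ∩ T).card) = p) =
        B.filter fun y => (b y).card = p.1 ∧ (b y ∩ T).card = p.2 := by
      refine filter_congr fun y _ => ?_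
      rw [Prod.ext_iff]
      constructor
      · exact fun h => h.2
      · exact fun h => ⟨by have := h.1; omega, h⟩
    rw [hset]
    refine sum_congr rfl fun y hy => ?_
    obtain ⟨-, h1, h2⟩ := mem_filter.mp hy
    have := card_union_add_card_inter T (b y)
    rw [inter_comm] at this
    congr 1
    omega
  rw [swap, swap, sum_congr rfl fun y _ => hg (T ∪ b y),
    sum_congr (s₁ := B) rfl fun y _ => hg (T' ∪ b y), split, split, hT]
  refine sum_congr rfl fun p hp => ?_
  rw [mem_product, mem_range, mem_range] at hp
  rw [h p.1 p.2 (by omega)]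

/-- The primal side of the MacWilliams-type identities. -/
theorem sum_supersets_card_disjoint [Fintype P] (A : Finset ι) (a : ι → Finset P) (T : Finset P)
    (m : ℕ) :
    ∑ V ∈ univ.filter (fun V : Finset P => T ⊆ V ∧ V.card = T.card + m),
        (A.filter fun x => Disjoint (a x) V).card =
      ∑ k ∈ range (Fintype.card P + 1),
        (A.filter fun x => (a x).card = k ∧ Disjoint (a x) T).card *
          (Fintype.card P - T.card - k).choose m := by
  conv_lhs =>
    simp only [card_filter _ A]
    rw [sum_comm]
  have hmaps : ∀ x ∈ A.filter (fun x => Disjoint (a x) T),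
      (a x).card ∈ range (Fintype.card P + 1) := fun x _ =>
    mem_range.mpr (Nat.lt_succ_of_le (card_le_univ _))
  have h1 : ∀ x ∈ A, (∑ V ∈ univ.filter (fun V : Finset P => T ⊆ V ∧ V.card = T.card + m),
      if Disjoint (a x) V then 1 else 0) =
      if Disjoint (a x) T then (Fintype.card P - T.card - (a x).card).choose m else 0 := by
    intro x _
    rw [← card_filter, filter_filter]
    split_ifs with hx
    · have hsub : T ⊆ (a x)ᶜ := subset_compl_iff_disjoint_left.mpr hx
      have := card_filter_between T (a x)ᶜ hsub m
      rw [card_compl] at this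
      rw [Nat.sub_right_comm, ← this]
      congr 1
      refine filter_congr fun V _ => ?_
      rw [subset_compl_iff_disjoint_left]
      tauto
    · rw [card_eq_zero, filter_false_of_mem]
      rintro V - ⟨⟨h1, -⟩, h2⟩
      exact hx (disjoint_of_subset_right h1 h2)
  rw [sum_congr rfl h1, ← sum_filter, ← sum_fiberwise_of_maps_to hmaps]
  refine sum_congr rfl fun k _ => ?_
  rw [filter_filter, ← smul_eq_mul, ← sum_const]
  refine sum_congr (filter_congr fun x _ => and_comm) fun x hx => ?_
  rw [(mem_filter.mp hx).2.1]

/-- The weight distributions of the members disjoint from `T` and from `T'` agree, if they agree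
outside a set `S` of weights and the dual family has the same intersection numbers with `T` and
`T'` for the weights below `|S| + |T|`. -/
theorem card_disjoint_eq_of_dual [Fintype P] (A : Finset ι) (a : ι → Finset P) (B : Finset κ)
    (b : κ → Finset P) (Q N : ℕ) (hQ : 0 < Q)
    (hdual : ∀ V : Finset P, Q ^ V.card * (A.filter fun x => Disjoint (a x) V).card =
      N * (B.filter fun y => b y ⊆ V).card)
    (S : Finset ℕ) (T T' : Finset P) (hT : T.card = T'.card)
    (hS : ∀ k ∈ S, k + T.card ≤ Fintype.card P)
    (hA : ∀ k ∉ S, (A.filter fun x => (a x).card = k ∧ Disjoint (a x) T).card =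
      (A.filter fun x => (a x).card = k ∧ Disjoint (a x) T').card)
    (hB : ∀ w j : ℕ, w < S.card + T.card →
      (B.filter fun y => (b y).card = w ∧ (b y ∩ T).card = j).card =
        (B.filter fun y => (b y).card = w ∧ (b y ∩ T').card = j).card) (k : ℕ) :
    (A.filter fun x => (a x).card = k ∧ Disjoint (a x) T).card =
      (A.filter fun x => (a x).card = k ∧ Disjoint (a x) T').card := by
  by_cases hk : k ∈ S
  swap
  · exact hA k hk
  have hSr : S ⊆ range (Fintype.card P + 1) := fun k hk => by
    have := hS k hk
    rw [mem_range]
    omega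
  refine eq_of_sum_mul_choose_eq S (fun k => Fintype.card P - T.card - k) ?_
    (fun k => (A.filter fun x => (a x).card = k ∧ Disjoint (a x) T).card)
    (fun k => (A.filter fun x => (a x).card = k ∧ Disjoint (a x) T').card) ?_ k hk
  -- By `hS` the subtraction does not truncate on S, so distinct weights give distinct nodes.
  · intro k hk l hl hkl
    have h1 := hS k hk
    have h2 := hS l hl
    simp only at hkl
    omega
  · intro m hm
    have moment : ∀ U : Finset P, Q ^ (U.card + m) *
        ∑ k ∈ range (Fintype.card P + 1),
          (A.filter fun x => (a x).card = k ∧ Disjoint (a x) U).card *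
            (Fintype.card P - U.card - k).choose m =
        N * ∑ V ∈ univ.filter (fun V : Finset P => U ⊆ V ∧ V.card = U.card + m),
          (B.filter fun y => b y ⊆ V).card := by
      intro U
      rw [← sum_supersets_card_disjoint, mul_sum, mul_sum]
      refine sum_congr rfl fun V hV => ?_
      rw [← hdual V, (mem_filter.mp hV).2.2]
    have h1 := moment T
    have h2 := moment T'
    rw [← hT] at h2
    rw [sum_supersets_card_eq B b T T' hT (T.card + m) fun w j hw => hB w j (by omega), ← h2] at h1
    have h3 := Nat.eq_of_mul_eq_mul_left (pow_pos hQ _) h1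
    -- The weights outside S contribute equally for T and T' and cancel, leaving |S| unknowns.
    rw [← sum_sdiff hSr, ← sum_sdiff hSr (f := fun k =>
      (A.filter fun x => (a x).card = k ∧ Disjoint (a x) T').card * _)] at h3
    rw [sum_congr rfl fun k hk => by rw [hA k (mem_sdiff.mp hk).2]] at h3
    exact Nat.add_left_cancel h3

/-! ### Dual codes and the MacWilliams identity for coordinate sets -/

variable {F : Type*} [Field F] {ν : ℕ}

theorem dualCode_eq_orthogonal (C : Submodule F (Fin ν → F)) :
    dualCode C = LinearMap.BilinForm.orthogonal (dotProductBilin F F) C := by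
  ext x
  rw [LinearMap.BilinForm.mem_orthogonal_iff]
  change (∀ c ∈ C, x ⬝ᵥ c = 0) ↔ ∀ c ∈ C, c ⬝ᵥ x = 0
  simp only [dotProduct_comm x]

theorem dotProductBilin_nondegenerate :
    LinearMap.BilinForm.Nondegenerate (dotProductBilin F F : LinearMap.BilinForm F (Fin ν → F)) := by
  constructor
  · intro x hx
    exact dotProduct_eq_zero x hx
  · intro x hx
    exact dotProduct_eq_zero x fun y => (dotProduct_comm x y).trans (hx y)

theorem dotProductBilin_isRefl :
    LinearMap.BilinForm.IsRefl (dotProductBilin F F : LinearMap.BilinForm F (Fin ν → F)) :=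
  fun x y h => (dotProduct_comm y x).trans h

theorem dualCode_dualCode (C : Submodule F (Fin ν → F)) : dualCode (dualCode C) = C := by
  rw [dualCode_eq_orthogonal, dualCode_eq_orthogonal]
  exact LinearMap.BilinForm.orthogonal_orthogonal dotProductBilin_nondegenerate
    dotProductBilin_isRefl C

theorem finrank_dualCode (C : Submodule F (Fin ν → F)) :
    Module.finrank F (dualCode C) = ν - Module.finrank F C := by
  rw [dualCode_eq_orthogonal, LinearMap.BilinForm.finrank_orthogonal dotProductBilin_nondegenerate,
    Module.finrank_fin_fun]

/-- The words vanishing on `V`. -/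
def vanishingOn (F : Type*) [Field F] {ν : ℕ} (V : Finset (Fin ν)) : Submodule F (Fin ν → F) :=
  ⨅ i ∈ (V : Set (Fin ν)), LinearMap.ker (LinearMap.proj i : (Fin ν → F) →ₗ[F] F)

theorem mem_vanishingOn {V : Finset (Fin ν)} {x : Fin ν → F} :
    x ∈ vanishingOn F V ↔ ∀ i ∈ V, x i = 0 := by
  simp [vanishingOn, Submodule.mem_iInf]

theorem finrank_vanishingOn (V : Finset (Fin ν)) :
    Module.finrank F (vanishingOn F V) = ν - V.card := by
  have e := LinearMap.iInfKerProjEquiv F (fun _ : Fin ν => F) (I := ((Vᶜ : Finset (Fin ν)) : Set _))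
    (J := (V : Set (Fin ν))) (by rw [coe_compl]; exact disjoint_compl_left)
    (by rw [coe_compl]; exact (Set.compl_union_self _).ge)
  rw [vanishingOn, e.finrank_eq, Module.finrank_pi]
  have h1 : Vᶜ.card = ν - V.card := by rw [card_compl, Fintype.card_fin]
  rw [← h1]
  exact Fintype.card_coe _

theorem dualCode_sup_vanishingOn (C : Submodule F (Fin ν → F)) (V : Finset (Fin ν)) :
    dualCode (C ⊔ vanishingOn F V) = dualCode C ⊓ vanishingOn F Vᶜ := by
  ext x
  rw [Submodule.mem_inf]
  constructor
  · intro hx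
    refine ⟨fun c hc => hx c (Submodule.mem_sup_left hc), mem_vanishingOn.mpr fun i hi => ?_⟩
    -- For i outside V the i-th unit vector vanishes on V; pairing with it extracts x i.
    have h1 := hx (Pi.single i 1) (Submodule.mem_sup_right (mem_vanishingOn.mpr fun j hj =>
      Pi.single_eq_of_ne (ne_of_mem_of_not_mem hj (mem_compl.mp hi)) _))
    exact (dotProduct_single_one x i).symm.trans h1
  · rintro ⟨h1, h2⟩ c hc
    obtain ⟨y, hy, z, hz, rfl⟩ := Submodule.mem_sup.mp hc
    have h3 : ∑ i, x i * z i = 0 := sum_eq_zero fun i _ => by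
      by_cases hi : i ∈ V
      · rw [mem_vanishingOn.mp hz i hi, mul_zero]
      · rw [mem_vanishingOn.mp h2 i (mem_compl.mpr hi), zero_mul]
    simp only [Pi.add_apply, mul_add, sum_add_distrib]
    rw [h1 y hy, h3, add_zero]

/-- The dimension formula for C and `vanishingOn F V`, combined with the dimension of the dual of
their sum. It is the MacWilliams identity on the level of exponents of q. -/
theorem card_add_finrank_inf_vanishingOn (C : Submodule F (Fin ν → F)) (V : Finset (Fin ν)) :
    V.card + Module.finrank F (C ⊓ vanishingOn F V : Submodule F (Fin ν → F)) =
      Module.finrank F C +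
        Module.finrank F (dualCode C ⊓ vanishingOn F Vᶜ : Submodule F (Fin ν → F)) := by
  rw [← dualCode_sup_vanishingOn, finrank_dualCode]
  have h1 := Submodule.finrank_sup_add_finrank_inf_eq C (vanishingOn F V)
  have h2 := Submodule.finrank_le (C ⊔ vanishingOn F V)
  rw [Module.finrank_fin_fun] at h2
  rw [finrank_vanishingOn] at h1
  have h3 : V.card ≤ ν := (card_le_univ V).trans (Fintype.card_fin ν).le
  omega

variable [DecidableEq F]

theorem mem_supp {c : Fin ν → F} {i : Fin ν} : i ∈ supp c ↔ c i ≠ 0 := by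
  simp [supp]

theorem card_supp (c : Fin ν → F) : (supp c).card = hammingNorm c := rfl

theorem supp_eq_empty {c : Fin ν → F} : supp c = ∅ ↔ c = 0 := by
  rw [← card_eq_zero, card_supp, hammingNorm_eq_zero]

theorem eq_zero_of_hammingNorm_lt {C : Submodule F (Fin ν → F)} {c : Fin ν → F} (hc : c ∈ C)
    (h : hammingNorm c < minWeight C) : c = 0 := by
  by_contra h0
  exact absurd (Nat.sInf_le ⟨c, hc, h0, rfl⟩ : minWeight C ≤ hammingNorm c) (not_le.mpr h)

variable [Fintype F]

open Classical in
/-- The words of a linear code, as a finite set. -/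
noncomputable def words (C : Submodule F (Fin ν → F)) : Finset (Fin ν → F) :=
  univ.filter fun c => c ∈ C

omit [DecidableEq F] in
@[simp]
theorem mem_words {C : Submodule F (Fin ν → F)} {c : Fin ν → F} : c ∈ words C ↔ c ∈ C := by
  simp [words]

omit [DecidableEq F] in
theorem card_words (C : Submodule F (Fin ν → F)) :
    (words C).card = Fintype.card F ^ Module.finrank F C := by
  classical
  rw [← Module.card_eq_pow_finrank, words, Fintype.card_subtype]

theorem words_filter_disjoint (C : Submodule F (Fin ν → F)) (V : Finset (Fin ν)) :
    ((words C).filter fun c => Disjoint (supp c) V) = words (C ⊓ vanishingOn F V) := by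
  ext c
  rw [mem_filter, mem_words, mem_words, Submodule.mem_inf, mem_vanishingOn, disjoint_right]
  simp [mem_supp]

theorem words_filter_subset (C : Submodule F (Fin ν → F)) (V : Finset (Fin ν)) :
    ((words C).filter fun c => supp c ⊆ V) = words (C ⊓ vanishingOn F Vᶜ) := by
  rw [← words_filter_disjoint]
  refine filter_congr fun c _ => ?_
  rw [disjoint_compl_right_iff]

/-- The MacWilliams identity for subsets of coordinates. -/
theorem card_pow_mul_card_disjoint (C : Submodule F (Fin ν → F)) (V : Finset (Fin ν)) :
    Fintype.card F ^ V.card * ((words C).filter fun c => Disjoint (supp c) V).card =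
      (words C).card * ((words (dualCode C)).filter fun c => supp c ⊆ V).card := by
  rw [words_filter_disjoint, words_filter_subset, card_words, card_words, card_words, ← pow_add,
    ← pow_add, card_add_finrank_inf_vanishingOn]

/-! ### Words with equal support -/

/-- Words with the same support in a code of which the nonzero words are heavy are proportional. -/
theorem exists_smul_eq_of_supp_eq {C : Submodule F (Fin ν → F)} {c c' : Fin ν → F} (hc : c ∈ C)
    (hc' : c' ∈ C) (hsupp : supp c = supp c')
    (h : ((supp c).card : ℤ) - (((supp c).card : ℤ) + (Fintype.card F : ℤ) - 2) /
      ((Fintype.card F : ℤ) - 1) < minWeight C) : ∃ a : Fˣ, c = a • c' := by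
  have hq : 2 ≤ Fintype.card F := Fintype.one_lt_card
  set k := (supp c).card with hk
  set q := Fintype.card F with hqdef
  -- Here r = ⌈k/(q-1)⌉, the pigeonhole bound for k positions and q - 1 possible ratios.
  obtain ⟨r, hr⟩ : ∃ r : ℕ, (r : ℤ) = ((k : ℤ) + (q : ℤ) - 2) / ((q : ℤ) - 1) :=
    ⟨(((k : ℤ) + (q : ℤ) - 2) / ((q : ℤ) - 1)).toNat,
      Int.toNat_of_nonneg (Int.ediv_nonneg (by omega) (by omega))⟩
  rw [← hr] at h
  -- some ratio occurs at least `r` times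
  have hpig : ∃ a : Fˣ, r ≤ ((supp c).filter fun i => c i = a • c' i).card := by
    by_contra! hno
    have hcover : (supp c).card = ∑ a : Fˣ, ((supp c).filter fun i => c i = a • c' i).card := by
      simp only [card_filter _ (supp c)]
      rw [sum_comm, card_eq_sum_ones]
      refine sum_congr rfl fun i hi => ?_
      have h1 : c i ≠ 0 := mem_supp.mp hi
      have h2 : c' i ≠ 0 := mem_supp.mp (hsupp ▸ hi)
      rw [← card_filter, eq_comm, card_eq_one]
      refine ⟨Units.mk0 (c i / c' i) (div_ne_zero h1 h2), ?_⟩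
      ext a
      rw [mem_filter, mem_singleton, Units.ext_iff, Units.val_mk0, Units.smul_def, smul_eq_mul,
        eq_div_iff h2, eq_comm]
      simp
    -- If every ratio occurred fewer than r times, then k ≤ (q-1)(r-1), against r(q-1) ≤ k + q - 2.
    have hle : (supp c).card ≤ ∑ _a : Fˣ, (r - 1) := hcover.le.trans
      (sum_le_sum fun a _ => by have := hno a; omega)
    rw [sum_const, card_univ, Fintype.card_units, smul_eq_mul, ← hk, ← hqdef] at hle
    have hr1 : 1 ≤ r := by have := hno 1; omega
    have hmul : (r : ℤ) * ((q : ℤ) - 1) ≤ (k : ℤ) + q - 2 := by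
      rw [hr]
      exact Int.ediv_mul_le _ (by omega)
    have hlt : (k : ℤ) + q - 2 < (r + 1 : ℤ) * ((q : ℤ) - 1) := by
      rw [hr]
      exact Int.lt_ediv_add_one_mul_self _ (by omega)
    zify [hr1, show 1 ≤ q by omega] at hle
    nlinarith
  obtain ⟨a, ha⟩ := hpig
  refine ⟨a, ?_⟩
  rw [← sub_eq_zero]
  refine eq_zero_of_hammingNorm_lt (C.sub_mem hc (C.smul_mem (a : F) hc')) ?_
  have hsub : supp (c - a • c') ⊆ supp c \ (supp c).filter fun i => c i = a • c' i := by
    intro i hi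
    rw [mem_supp, Pi.sub_apply, Pi.smul_apply, sub_ne_zero] at hi
    rw [mem_sdiff, mem_filter]
    refine ⟨?_, fun h => hi h.2⟩
    rw [mem_supp]
    intro h0
    have h1 : c' i = 0 := by
      by_contra h1
      exact (mem_supp.mp (hsupp ▸ mem_supp.mpr h1 : i ∈ supp c)) h0
    exact hi (by rw [h0, h1, smul_zero])
  have hcard := card_le_card hsub
  rw [card_sdiff_of_subset (filter_subset _ _), card_supp, ← hk] at hcard
  have hlek : ((supp c).filter fun i => c i = a • c' i).card ≤ k := card_le_card (filter_subset _ _)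
  have : hammingNorm (c - a • c') < minWeight C := by omega
  exact this

/-- Since q - 1 ≥ 1, the quotient grows by at most w - k. Hence the simplicity inequality at w
passes to every smaller weight. -/
theorem sub_ediv_mono {q k w : ℤ} (hq : 2 ≤ q) (hkw : k ≤ w) :
    k - (k + q - 2) / (q - 1) ≤ w - (w + q - 2) / (q - 1) := by
  have h1 : (w + q - 2) / (q - 1) ≤ (k + q - 2 + (w - k) * (q - 1)) / (q - 1) :=
    Int.ediv_le_ediv (by omega) (by nlinarith)
  rw [Int.add_mul_ediv_right _ _ (by omega)] at h1
  omega

/-- The words of `C` with a given nonempty support fall into classes of `q - 1` scalar multiples. -/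
theorem dvd_card_filter_supp_eq (C : Submodule F (Fin ν → F)) (b : Finset (Fin ν))
    (hb : b.Nonempty) :
    (Fintype.card F - 1) ∣ ((words C).filter fun c => supp c = b).card := by
  obtain ⟨i, hi⟩ := hb
  have hmaps : ∀ c ∈ (words C).filter (fun c => supp c = b), c i ∈ univ.filter fun a : F => a ≠ 0 := by
    intro c hc
    rw [mem_filter, ← mem_supp, (mem_filter.mp hc).2]
    exact ⟨mem_univ _, hi⟩
  rw [card_eq_sum_card_fiberwise hmaps]
  have hcard : (univ.filter fun a : F => a ≠ 0).card = Fintype.card F - 1 := by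
    rw [filter_ne' univ, card_erase_of_mem (mem_univ _), card_univ]
  -- Scaling by a is a bijection from the words with value 1 at i to those with value a.
  have hfib : ∀ a ∈ univ.filter (fun a : F => a ≠ 0),
      (((words C).filter fun c => supp c = b).filter fun c => c i = a).card =
        (((words C).filter fun c => supp c = b).filter fun c => c i = 1).card := by
    intro a ha
    have ha0 : a ≠ 0 := (mem_filter.mp ha).2
    have hsm : ∀ (u : F) (c : Fin ν → F), u ≠ 0 → supp (u • c) = supp c := by
      intro u c hu
      ext j
      simp [mem_supp, hu]
    refine card_bij' (fun c _ => a⁻¹ • c) (fun c _ => a • c) ?_ ?_ ?_ ?_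
    · intro c hc
      simp only [mem_filter, mem_words] at hc ⊢
      exact ⟨⟨C.smul_mem _ hc.1.1, by rw [hsm _ _ (inv_ne_zero ha0), hc.1.2]⟩,
        by rw [Pi.smul_apply, smul_eq_mul, hc.2, inv_mul_cancel₀ ha0]⟩
    · intro c hc
      simp only [mem_filter, mem_words] at hc ⊢
      exact ⟨⟨C.smul_mem _ hc.1.1, by rw [hsm _ _ ha0, hc.1.2]⟩,
        by rw [Pi.smul_apply, smul_eq_mul, hc.2, mul_one]⟩
    · intro c _
      exact smul_inv_smul₀ ha0 c
    · intro c _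
      exact inv_smul_smul₀ ha0 c
  rw [sum_congr rfl hfib, sum_const, hcard, smul_eq_mul]
  exact dvd_mul_right _ _

/-! ### From codewords to blocks -/

theorem supports_eq (C : Submodule F (Fin ν → F)) (k : ℕ) :
    supports C k = ((words C).filter fun c => (supp c).card = k).val.map supp := by
  classical
  have h : ((words C).filter fun c => (supp c).card = k) =
      univ.filter fun c => c ∈ C ∧ hammingNorm c = k := by
    ext c
    rw [mem_filter, mem_filter, mem_words, card_supp]
    exact ⟨fun h => ⟨mem_univ _, h⟩, fun h => h.2⟩
  rw [h, supports]

theorem count_supports (C : Submodule F (Fin ν → F)) (k : ℕ) (b : Finset (Fin ν)) :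
    (supports C k).count b = if b.card = k then ((words C).filter fun c => supp c = b).card else 0 := by
  rw [supports_eq, Multiset.count_map, ← filter_val, card_val, filter_filter]
  split_ifs with hb
  · congr 1
    refine filter_congr fun c _ => ?_
    constructor
    · exact fun h => h.2.symm
    · rintro rfl
      exact ⟨hb, rfl⟩
  · rw [card_eq_zero, filter_false_of_mem]
    rintro c - ⟨h1, rfl⟩
    exact hb h1

theorem card_eq_of_mem_blocks {C : Submodule F (Fin ν → F)} {k : ℕ} {b : Finset (Fin ν)}
    (hb : b ∈ blocks C k) : b.card = k := by
  rw [← Multiset.count_pos, blocks, count_divMult, count_supports] at hb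
  by_contra h
  rw [if_neg h, Nat.zero_div] at hb
  exact lt_irrefl _ hb

theorem card_sub_one_mul_count_blocks (C : Submodule F (Fin ν → F)) {k : ℕ} (hk : 0 < k)
    (b : Finset (Fin ν)) :
    (Fintype.card F - 1) * (blocks C k).count b = (supports C k).count b := by
  rw [blocks, count_divMult]
  refine Nat.mul_div_cancel' ?_
  rw [count_supports]
  split_ifs with hb
  · exact dvd_card_filter_supp_eq C b (card_pos.mp (hb ▸ hk))
  · exact dvd_zero _

theorem card_filter_blocks (C : Submodule F (Fin ν → F)) {k : ℕ} (T : Finset (Fin ν))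
    (hT : T.Nonempty) :
    (Fintype.card F - 1) * ((blocks C k).filter fun b => T ⊆ b).card =
      (((words C).filter fun c => (supp c).card = k).filter fun c => T ⊆ supp c).card := by
  -- For k = 0 the division by q - 1 may round, but an empty block cannot contain the nonempty T, so
  -- both sides vanish.
  rcases Nat.eq_zero_or_pos k with rfl | hk
  · rw [Multiset.filter_eq_nil.mpr, Multiset.card_zero, mul_zero, eq_comm, card_eq_zero,
      filter_false_of_mem]
    · intro c hc h
      rw [card_eq_zero.mp (mem_filter.mp hc).2, subset_empty] at h
      exact hT.ne_empty h
    · intro b hb h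
      rw [card_eq_zero.mp (card_eq_of_mem_blocks hb), subset_empty] at h
      exact hT.ne_empty h
  · have hns : (Fintype.card F - 1) • blocks C k = supports C k := by
      ext b
      rw [Multiset.count_nsmul, card_sub_one_mul_count_blocks C hk]
    rw [← Multiset.card_nsmul, ← Multiset.filter_nsmul, hns, supports_eq,
      Multiset.filter_map, Multiset.card_map]
    rfl

theorem isTDesign_blocks_iff (C : Submodule F (Fin ν → F)) {t k : ℕ} (ht : 0 < t) (htν : t ≤ ν)
    (hk : k ≤ ν) :
    IsTDesign (blocks C k) t k ↔ ∀ T T' : Finset (Fin ν), T.card = t → T'.card = t →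
      (((words C).filter fun c => (supp c).card = k).filter fun c => T ⊆ supp c).card =
      (((words C).filter fun c => (supp c).card = k).filter fun c => T' ⊆ supp c).card := by
  have hq : 0 < Fintype.card F - 1 := Nat.sub_pos_of_lt Fintype.one_lt_card
  constructor
  · rintro ⟨lam, h⟩ T T' hT hT'
    rw [← card_filter_blocks C T (card_pos.mp (hT ▸ ht)),
      ← card_filter_blocks C T' (card_pos.mp (hT' ▸ ht)), h.card_containing T hT,
      h.card_containing T' hT']
  · intro h
    obtain ⟨T₀, -, hT₀⟩ := exists_subset_card_eq
      (show t ≤ (univ : Finset (Fin ν)).card by simpa using htν)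
    refine ⟨((blocks C k).filter fun b => T₀ ⊆ b).card, ht, by simpa using htν, by simpa using hk,
      fun b hb => card_eq_of_mem_blocks hb, fun T hT => ?_⟩
    apply Nat.eq_of_mul_eq_mul_left hq
    rw [card_filter_blocks C T (card_pos.mp (hT ▸ ht)),
      card_filter_blocks C T₀ (card_pos.mp (hT₀ ▸ ht)), h T T₀ hT hT₀]

/-- All words with a given support are unit multiples of one of them, so there are at most q - 1,
and the divided multiplicity is at most 1. -/
theorem nodup_blocks (C : Submodule F (Fin ν → F)) {k : ℕ} {w : ℤ}
    (hw : IsSimpleBound (Fintype.card F) ν (minWeight C) w) (hkw : (k : ℤ) ≤ w) :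
    (blocks C k).Nodup := by
  have hq : 1 < Fintype.card F := Fintype.one_lt_card
  rw [Multiset.nodup_iff_count_le_one]
  intro b
  rw [blocks, count_divMult, count_supports]
  split_ifs with hb
  swap
  · rw [Nat.zero_div]; exact zero_le_one
  have hbound : (b.card : ℤ) - ((b.card : ℤ) + (Fintype.card F : ℤ) - 2) /
      ((Fintype.card F : ℤ) - 1) < minWeight C :=
    (sub_ediv_mono (by exact_mod_cast hq) (hb ▸ hkw)).trans_lt hw.1.2
  have hle : ((words C).filter fun c => supp c = b).card ≤ Fintype.card F - 1 := by
    rcases ((words C).filter fun c => supp c = b).eq_empty_or_nonempty with he | ⟨c', hc'⟩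
    · rw [he, card_empty]; exact Nat.zero_le _
    · rw [mem_filter, mem_words] at hc'
      rw [← Fintype.card_units, ← card_univ]
      refine (card_le_card (t := univ.image fun a : Fˣ => a • c') ?_).trans card_image_le
      intro c hc
      rw [mem_filter, mem_words] at hc
      obtain ⟨a, ha⟩ := exists_smul_eq_of_supp_eq hc.1 hc'.1 (hc.2.trans hc'.2.symm)
        (by rw [hc.2]; exact hbound)
      exact mem_image.mpr ⟨a, mem_univ _, ha.symm⟩
  exact (Nat.div_le_div_right hle).trans (Nat.div_self (Nat.sub_pos_of_lt hq)).le

/-! ### Regularity of the words of fixed weight -/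

theorem coverRegular_words_of_lt_minWeight (C : Submodule F (Fin ν → F)) (t : ℕ) {k : ℕ}
    (hk : k < minWeight C) :
    CoverRegular ((words C).filter fun c => (supp c).card = k) supp t := by
  refine coverRegular_of_empty t fun c hc => ?_
  rw [mem_filter, mem_words] at hc
  exact supp_eq_empty.mpr (eq_zero_of_hammingNorm_lt hc.1 (by rw [← card_supp, hc.2]; exact hk))

/-- Below the minimum weight only the zero word can occur. From the minimum weight on, t < k, so the
t-design property descends to smaller sets. -/
theorem coverRegular_words_of_isTDesign (C : Submodule F (Fin ν → F)) {t k : ℕ} (ht : 0 < t)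
    (htd : t < minWeight C) (htν : t ≤ ν) (hk : k ≤ ν) (h : IsTDesign (blocks C k) t k) :
    CoverRegular ((words C).filter fun c => (supp c).card = k) supp t := by
  rcases lt_or_ge k (minWeight C) with hkd | hkd
  · exact coverRegular_words_of_lt_minWeight C t hkd
  · exact coverRegular_of_card_eq (fun c hc => (mem_filter.mp hc).2) (htd.le.trans hkd)
      ((isTDesign_blocks_iff C ht htν hk).mp h)

theorem isTDesign_of_coverRegular (C : Submodule F (Fin ν → F)) {t k : ℕ} (ht : 0 < t)
    (htν : t ≤ ν) (hk : k ≤ ν)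
    (h : CoverRegular ((words C).filter fun c => (supp c).card = k) supp t) :
    IsTDesign (blocks C k) t k :=
  (isTDesign_blocks_iff C ht htν hk).mpr fun T T' hT hT' =>
    h T T' (hT.trans hT'.symm) hT.le

/-- If `S i` contains, for every `i ≤ t`, all weights at most `ν - i` for which the words of `C` are
not known to be regular, and the words of the dual code are regular for all weights below
`|S i| + i`, then the words of `C` are regular for all weights. -/
theorem coverRegular_words_of_dual (C : Submodule F (Fin ν → F)) (t : ℕ) (S : ℕ → Finset ℕ)
    (hS : ∀ i ≤ t, ∀ k ∈ S i, k + i ≤ ν)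
    (hC : ∀ i ≤ t, ∀ k, k + i ≤ ν → k ∉ S i →
      CoverRegular ((words C).filter fun c => (supp c).card = k) supp t)
    (hD : ∀ i ≤ t, ∀ k < (S i).card + i,
      CoverRegular ((words (dualCode C)).filter fun c => (supp c).card = k) supp t) (k : ℕ) :
    CoverRegular ((words C).filter fun c => (supp c).card = k) supp t := by
  refine coverRegular_of_card_disjoint fun T T' hT ht => ?_
  rw [filter_filter, filter_filter]
  refine card_disjoint_eq_of_dual (words C) supp (words (dualCode C)) supp (Fintype.card F)
    (words C).card Fintype.card_pos (card_pow_mul_card_disjoint C) (S T.card) T T' hT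
    (by simpa using hS T.card ht) ?_ ?_ k
  · intro l hl
    rcases le_or_gt (l + T.card) ν with hlν | hlν
    · rw [← filter_filter, ← filter_filter]
      exact (hC T.card ht l hlν hl).card_disjoint T T' hT ht
    -- A support of size above ν - |T| has no room to avoid a set of size |T|.
    · have none : ∀ U : Finset (Fin ν), U.card = T.card →
          ((words C).filter fun c => (supp c).card = l ∧ Disjoint (supp c) U).card = 0 := by
        intro U hU
        rw [card_eq_zero, filter_false_of_mem]
        rintro c - ⟨h1, h2⟩
        have h3 := card_le_univ (supp c ∪ U)
        rw [card_union_of_disjoint h2, Fintype.card_fin] at h3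
        omega
      rw [none T rfl, none T' hT.symm]
  · intro w j hw
    rw [← filter_filter, ← filter_filter]
    exact (hD T.card ht w hw).card_inter T T' hT ht j

end DesignCode

/-! ### The generalized Assmus–Mattson theorem -/

theorem mainTheorem1 {F : Type*} [Field F] [Fintype F] [DecidableEq F] (ν : ℕ)
    (C : Submodule F (Fin ν → F)) (s t : ℕ) (hs : 0 < s) (ht : 0 < t)
    (htd : t < min (DesignCode.minWeight C) (DesignCode.minWeight (DesignCode.dualCode C)))
    (S : Finset ℕ) (hS : S ⊆ Finset.Icc (DesignCode.minWeight C) (ν - t)) (hScard : S.card = s)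
    (hC : ∀ l ∈ Finset.Icc (DesignCode.minWeight C) (ν - t) \ S,
      DesignCode.IsTDesign (DesignCode.blocks C l) t l)
    (hCdual : ∀ l : ℕ, l ≤ s + t - 1 →
      DesignCode.IsTDesign (DesignCode.blocks (DesignCode.dualCode C) l) t l) :
    (∀ k : ℕ, t ≤ k → k ≤ ν →
      DesignCode.IsTDesign (DesignCode.blocks C k) t k ∧
      DesignCode.IsTDesign (DesignCode.blocks (DesignCode.dualCode C) k) t k) ∧
    (∀ w : ℤ, DesignCode.IsSimpleBound (Fintype.card F) ν (DesignCode.minWeight C) w →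
      ∀ k : ℕ, DesignCode.minWeight C ≤ k → (k : ℤ) ≤ w →
        DesignCode.IsSimpleTDesign (DesignCode.blocks C k) t k) ∧
    (∀ w : ℤ, DesignCode.IsSimpleBound (Fintype.card F) ν
        (DesignCode.minWeight (DesignCode.dualCode C)) w →
      ∀ k : ℕ, min (DesignCode.minWeight C) (DesignCode.minWeight (DesignCode.dualCode C)) ≤ k →
        (k : ℤ) ≤ w →
        DesignCode.IsSimpleTDesign (DesignCode.blocks (DesignCode.dualCode C) k) t k) := by
  obtain ⟨htC, htD⟩ := lt_min_iff.mp htd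
  set d := DesignCode.minWeight C with hd
  have hSne : S.Nonempty := Finset.card_pos.mp (hScard ▸ hs)
  -- An element of S gives t < d ≤ ν - t, hence t ≤ ν.
  obtain ⟨k₀, hk₀⟩ := hSne
  have hk₀' := Finset.mem_Icc.mp (hS hk₀)
  have htν : t ≤ ν := by omega
  have regD : ∀ k : ℕ, k ≤ s + t - 1 → DesignCode.CoverRegular
      ((DesignCode.words (DesignCode.dualCode C)).filter fun c => (DesignCode.supp c).card = k)
      DesignCode.supp t := by
    intro k hk
    have h := hCdual k hk
    obtain ⟨lam, hlam⟩ := id h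
    exact DesignCode.coverRegular_words_of_isTDesign _ ht htD htν
      (by simpa using hlam.k_le_card) h
  have regC : ∀ k : ℕ, DesignCode.CoverRegular
      ((DesignCode.words C).filter fun c => (DesignCode.supp c).card = k) DesignCode.supp t := by
    refine DesignCode.coverRegular_words_of_dual C t
      -- The hypothesis on C stops at ν - t, so for |T| = i the t - i weights from ν - t + 1 to ν -
      -- i are added to the unknowns. The total with i is at most s + t, matching the range of
      -- `hCdual`.
      (fun i => S ∪ Finset.Icc (ν - t + 1) (ν - i)) ?_ ?_ ?_
    · intro i hi k hk
      rcases Finset.mem_union.mp hk with hk | hk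
      · have := Finset.mem_Icc.mp (hS hk)
        omega
      · have := Finset.mem_Icc.mp hk
        omega
    · intro i hi k hki hk
      rw [Finset.mem_union, Finset.mem_Icc, not_or] at hk
      rcases lt_or_ge k d with hkd | hkd
      · exact DesignCode.coverRegular_words_of_lt_minWeight C t hkd
      · refine DesignCode.coverRegular_words_of_isTDesign C ht htC htν (by omega) (hC k ?_)
        rw [Finset.mem_sdiff, Finset.mem_Icc]
        exact ⟨⟨hkd, by omega⟩, hk.1⟩
    · intro i hi k hk
      refine regD k ?_
      have h1 := Finset.card_union_le S (Finset.Icc (ν - t + 1) (ν - i))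
      rw [Nat.card_Icc, hScard] at h1
      omega
  have regD' : ∀ k : ℕ, DesignCode.CoverRegular
      ((DesignCode.words (DesignCode.dualCode C)).filter fun c => (DesignCode.supp c).card = k)
      DesignCode.supp t := by
    refine DesignCode.coverRegular_words_of_dual (DesignCode.dualCode C) t
      -- All weights of the dual code up to ν - i are treated as unknown; this is affordable because
      -- C is now regular in every weight.
      (fun i => Finset.range (ν - i + 1)) ?_ ?_ ?_
    · intro i hi k hk
      rw [Finset.mem_range] at hk
      omega
    · intro i hi k hki hk
      rw [Finset.mem_range] at hk
      omega
    · intro i hi k hk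
      rw [DesignCode.dualCode_dualCode]
      exact regC k
  refine ⟨fun k _ hkν => ⟨DesignCode.isTDesign_of_coverRegular C ht htν hkν (regC k),
    DesignCode.isTDesign_of_coverRegular _ ht htν hkν (regD' k)⟩, ?_, ?_⟩
  · intro w hw k _ hkw
    have hkν : k ≤ ν := by exact_mod_cast hkw.trans hw.1.1
    exact ⟨DesignCode.isTDesign_of_coverRegular C ht htν hkν (regC k),
      DesignCode.nodup_blocks C hw hkw⟩
  · intro w hw k _ hkw
    have hkν : k ≤ ν := by exact_mod_cast hkw.trans hw.1.1
    exact ⟨DesignCode.isTDesign_of_coverRegular _ ht htν hkν (regD' k),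
      DesignCode.nodup_blocks _ hw hkw⟩
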